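/- For a semigroup $S$ and $a\in S$, an element $b \in S$ is an inverse of $a$ if $aba=a$ and $bab=b$. A permutation matching of $S$ is a permutation $f$ of $S$ such that $f(a)$ is an inverse of $a$ for every $a\in S$; it is an involution matching if moreover $f^2$ is the identity map. A semigroup $S$ is $E$-solid if it is regular and, for all idempotents $e,f,g\in S$ with $e\,\mathcal{L}\,f\,\mathcal{R}\,g$, there is an idempotent $h\in S$ with $e\,\mathcal{R}\,h\,\mathcal{L}\,g$. For $a\in S$ let $D_a$ be its $\mathcal{D}$-class and let $D_a\cup\{0\}$ be the principal factor of $a$, with an adjoined zero $0$, in which the product of $x,y\in D_a$ is $xy$ if $xy\in D_a$ and $0$ otherwise; let $B_a=(D_a\cup\{0\})/\mathcal{H}$ be its quotient by Green's relation $\mathcal{H}$. For $S$ finite and regular, $B_a$ is a $0$-rectangular band, i.e. a completely $0$-simple semigroup with trivial $\mathcal{H}$-relation. A rectangular band is a nonempty semigroup of idempotents satisfying $xyx=x$. Two finite rectangular bands $U_1,U_2$ are similar if $m_1/n_1=m_2/n_2$, where $m_i$ and $n_i$ are the numbers of $\mathcal{R}$-classes and of $\mathcal{L}$-classes of $U_i$.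 Theorem. Let $S$ be a finite $E$-solid semigroup. Then $S$ has a permutation matching if and only if, for every $a\in S$, the maximal rectangular subbands of $B_a$ that do not contain $0$ are pairwise similar. Moreover, if $S$ has a permutation matching, then $S$ has an involution matching. -/

import Mathlib

namespace InverseMatching

/-- `b` is an inverse of `a`, that is, `b ∈ V(a)`. -/
def IsInverse {S : Type*} [Semigroup S] (a b : S) : Prop :=
  a * b * a = a ∧ b * a * b = b

/-- A map sending each element of `S` to one of its inverses. -/
def IsInverseMatching {S : Type*} [Semigroup S] (f : S → S) : Prop :=
  ∀ a, IsInverse a (f a)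

/-- A permutation of `S` sending each element to one of its inverses. -/
def IsPermutationMatching {S : Type*} [Semigroup S] (f : S → S) : Prop :=
  IsInverseMatching f ∧ Function.Bijective f

/-- A permutation matching whose square is the identity. -/
def IsInvolutionMatching {S : Type*} [Semigroup S] (f : S → S) : Prop :=
  IsPermutationMatching f ∧ f ∘ f = id

/-- Green's relation `𝓛`: `S¹ a = S¹ b`, where `S¹` is `WithOne S`. -/
def GreenL {S : Type*} [Semigroup S] (a b : S) : Prop :=
  (∃ u : WithOne S, (a : WithOne S) = u * b) ∧ (∃ u : WithOne S, (b : WithOne S) = u * a)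

/-- Green's relation `𝓡`: `a S¹ = b S¹`. -/
def GreenR {S : Type*} [Semigroup S] (a b : S) : Prop :=
  (∃ u : WithOne S, (a : WithOne S) = b * u) ∧ (∃ u : WithOne S, (b : WithOne S) = a * u)

/-- Green's relation `𝓗 = 𝓛 ∩ 𝓡`. -/
def GreenH {S : Type*} [Semigroup S] (a b : S) : Prop :=
  GreenL a b ∧ GreenR a b

/-- Green's relation `𝓓 = 𝓛 ∘ 𝓡`. -/
def GreenD {S : Type*} [Semigroup S] (a b : S) : Prop :=
  ∃ c, GreenL a c ∧ GreenR c b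

/-- Every element is regular. -/
def IsRegularSemigroup (S : Type*) [Semigroup S] : Prop :=
  ∀ a : S, ∃ x : S, a * x * a = a

/-- `E`-solid semigroups: regular semigroups in which `e 𝓛 f 𝓡 g` for idempotents `e, f, g`
implies `e 𝓡 h 𝓛 g` for some idempotent `h`. -/
def IsESolid (S : Type*) [Semigroup S] : Prop :=
  IsRegularSemigroup S ∧
    ∀ e f g : S, IsIdempotentElem e → IsIdempotentElem f → IsIdempotentElem g →
      GreenL e f → GreenR f g → ∃ h : S, IsIdempotentElem h ∧ GreenR e h ∧ GreenL h g

/-! Basic facts on Green's relations, needed for the two constructions below. -/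

section Green

variable {S : Type*} [Semigroup S]

/-- The quasi-order `a ≤ b` in the sense of `S¹ a S¹ ⊆ S¹ b S¹`. -/
def LeJ (a b : S) : Prop :=
  ∃ u v : WithOne S, (a : WithOne S) = u * b * v

theorem GreenL.refl (a : S) : GreenL a a := ⟨⟨1, by simp⟩, ⟨1, by simp⟩⟩

theorem GreenR.refl (a : S) : GreenR a a := ⟨⟨1, by simp⟩, ⟨1, by simp⟩⟩

theorem GreenL.symm {a b : S} (h : GreenL a b) : GreenL b a := ⟨h.2, h.1⟩

theorem GreenR.symm {a b : S} (h : GreenR a b) : GreenR b a := ⟨h.2, h.1⟩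

theorem GreenL.trans {a b c : S} (h : GreenL a b) (k : GreenL b c) : GreenL a c := by
  obtain ⟨⟨u, hu⟩, ⟨v, hv⟩⟩ := h
  obtain ⟨⟨u', hu'⟩, ⟨v', hv'⟩⟩ := k
  exact ⟨⟨u * u', by rw [hu, hu', mul_assoc]⟩, ⟨v' * v, by rw [hv', hv, mul_assoc]⟩⟩

theorem GreenR.trans {a b c : S} (h : GreenR a b) (k : GreenR b c) : GreenR a c := by
  obtain ⟨⟨u, hu⟩, ⟨v, hv⟩⟩ := h
  obtain ⟨⟨u', hu'⟩, ⟨v', hv'⟩⟩ := k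
  exact ⟨⟨u' * u, by rw [hu, hu', mul_assoc]⟩, ⟨v * v', by rw [hv', hv, mul_assoc]⟩⟩

theorem GreenL.mul_right {a b : S} (h : GreenL a b) (c : S) : GreenL (a * c) (b * c) := by
  obtain ⟨⟨u, hu⟩, ⟨v, hv⟩⟩ := h
  exact ⟨⟨u, by rw [WithOne.coe_mul, WithOne.coe_mul, hu, mul_assoc]⟩,
    ⟨v, by rw [WithOne.coe_mul, WithOne.coe_mul, hv, mul_assoc]⟩⟩

theorem GreenR.mul_left {a b : S} (h : GreenR a b) (c : S) : GreenR (c * a) (c * b) := by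
  obtain ⟨⟨u, hu⟩, ⟨v, hv⟩⟩ := h
  exact ⟨⟨u, by rw [WithOne.coe_mul, WithOne.coe_mul, hu, mul_assoc]⟩,
    ⟨v, by rw [WithOne.coe_mul, WithOne.coe_mul, hv, mul_assoc]⟩⟩

theorem LeJ.trans {a b c : S} (h : LeJ a b) (k : LeJ b c) : LeJ a c := by
  obtain ⟨u, v, hu⟩ := h
  obtain ⟨u', v', hu'⟩ := k
  exact ⟨u * u', v' * v, by rw [hu, hu']; simp only [mul_assoc]⟩

theorem GreenL.leJ {a b : S} (h : GreenL a b) : LeJ a b := by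
  obtain ⟨⟨u, hu⟩, _⟩ := h
  exact ⟨u, 1, by rw [hu, mul_one]⟩

theorem GreenR.leJ {a b : S} (h : GreenR a b) : LeJ a b := by
  obtain ⟨⟨u, hu⟩, _⟩ := h
  exact ⟨1, u, by rw [hu, one_mul]⟩

theorem leJ_mul_left (a b : S) : LeJ (a * b) a := ⟨1, b, by simp⟩

theorem leJ_mul_right (a b : S) : LeJ (a * b) b := ⟨a, 1, by simp⟩

theorem exists_idempotent_pow {M : Type*} [Monoid M] [Finite M] (x : M) :
    ∃ n : ℕ, 0 < n ∧ x ^ n * x ^ n = x ^ n := by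
  obtain ⟨i, j, hij, h⟩ := Finite.exists_ne_map_eq_of_infinite (fun n : ℕ => x ^ n)
  wlog hlt : i < j generalizing i j
  · exact this j i hij.symm h.symm (by omega)
  obtain ⟨d, rfl⟩ := Nat.exists_eq_add_of_lt hlt
  have h' : x ^ i = x ^ (i + d + 1) := h
  have key : ∀ k m : ℕ, i ≤ m → x ^ (m + k * (d + 1)) = x ^ m := by
    intro k m hm
    induction k with
    | zero => simp
    | succ k ih =>
      obtain ⟨t, rfl⟩ := Nat.exists_eq_add_of_le hm
      rw [show i + t + (k + 1) * (d + 1) = (i + d + 1) + (t + k * (d + 1)) by ring, pow_add, ← h',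
        ← pow_add, ← ih]
      congr 1
      ring
  refine ⟨(i + 1) * (d + 1), by positivity, ?_⟩
  rw [← pow_add]
  exact key (i + 1) _ (by nlinarith)

theorem eq_pow_mul_pow {M : Type*} [Monoid M] {x u w : M} (h : x = u * x * w) (n : ℕ) :
    x = u ^ n * x * w ^ n := by
  induction n with
  | zero => simp
  | succ n ih =>
    calc x = u ^ n * (u * x * w) * w ^ n := by rw [← h]; exact ih
      _ = u ^ (n + 1) * x * w ^ (n + 1) := by rw [pow_succ, pow_succ']; simp only [mul_assoc]

theorem greenR_mul_of_leJ [Finite S] {x y : S} (h : LeJ x (x * y)) : GreenR (x * y) x := by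
  obtain ⟨u, v, h⟩ := h
  have : Finite (WithOne S) := inferInstanceAs (Finite (Option S))
  refine ⟨⟨y, by simp⟩, ?_⟩
  obtain ⟨n, hn, hi⟩ := exists_idempotent_pow ((y : WithOne S) * v)
  have h1 : (x : WithOne S) = u * x * (y * v) := by
    rw [WithOne.coe_mul] at h; simpa only [mul_assoc] using h
  have h2 := eq_pow_mul_pow h1 n
  have h3 : (x : WithOne S) = x * ((y : WithOne S) * v) ^ n := by
    conv_rhs => rw [h2, mul_assoc, hi]
    exact h2
  obtain ⟨m, rfl⟩ := Nat.exists_eq_succ_of_ne_zero hn.ne'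
  refine ⟨v * ((y : WithOne S) * v) ^ m, ?_⟩
  rw [pow_succ'] at h3
  rw [WithOne.coe_mul]
  simpa only [mul_assoc] using h3

theorem greenL_mul_of_leJ [Finite S] {x y : S} (h : LeJ y (x * y)) : GreenL (x * y) y := by
  obtain ⟨u, v, h⟩ := h
  have : Finite (WithOne S) := inferInstanceAs (Finite (Option S))
  refine ⟨⟨x, by simp⟩, ?_⟩
  obtain ⟨n, hn, hi⟩ := exists_idempotent_pow (u * (x : WithOne S))
  have h1 : (y : WithOne S) = (u * x) * y * v := by
    rw [WithOne.coe_mul] at h; simpa only [mul_assoc] using h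
  have h2 := eq_pow_mul_pow h1 n
  have h3 : (y : WithOne S) = (u * (x : WithOne S)) ^ n * y := by
    conv_rhs => rw [h2, ← mul_assoc, ← mul_assoc, hi]
    exact h2
  obtain ⟨m, rfl⟩ := Nat.exists_eq_succ_of_ne_zero hn.ne'
  refine ⟨(u * (x : WithOne S)) ^ m * u, ?_⟩
  rw [pow_succ] at h3
  rw [WithOne.coe_mul]
  simpa only [mul_assoc] using h3

theorem GreenD.leJ {a b : S} (h : GreenD a b) : LeJ a b := by
  obtain ⟨c, h1, h2⟩ := h
  exact h1.leJ.trans h2.leJ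

theorem GreenD.leJ' {a b : S} (h : GreenD a b) : LeJ b a := by
  obtain ⟨c, h1, h2⟩ := h
  exact h2.symm.leJ.trans h1.symm.leJ

/-- In a finite semigroup, `𝓓 = 𝓙`. -/
theorem greenD_iff [Finite S] {a b : S} : GreenD a b ↔ LeJ a b ∧ LeJ b a := by
  refine ⟨fun h => ⟨h.leJ, h.leJ'⟩, ?_⟩
  rintro ⟨⟨u, v, h⟩, hba⟩
  have hR : ∃ c : S, (c : WithOne S) = b * v ∧ GreenR c b := by
    induction v using WithOne.recOneCoe with
    | one => exact ⟨b, by simp, GreenR.refl b⟩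
    | coe v =>
      refine ⟨b * v, by simp, greenR_mul_of_leJ (hba.trans ⟨u, 1, ?_⟩)⟩
      rw [h]; simp [mul_assoc]
  obtain ⟨c, hc, hcb⟩ := hR
  have hac : (a : WithOne S) = u * c := by rw [h, hc, mul_assoc]
  refine ⟨c, ?_, hcb⟩
  induction u using WithOne.recOneCoe with
  | one =>
    rw [one_mul] at hac
    rw [WithOne.coe_inj.1 hac]
    exact GreenL.refl c
  | coe u =>
    have e : a = u * c := by rw [← WithOne.coe_inj, hac, WithOne.coe_mul]
    have := hcb.leJ.trans hba
    rw [e] at this ⊢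
    exact greenL_mul_of_leJ this

end Green

/-- The `𝓓`-class `D_a`. -/
abbrev DClass {S : Type*} [Semigroup S] (a : S) : Type _ := {x : S // GreenD a x}

/-- The principal factor `D_a ∪ {0}`. -/
def PrincipalFactor {S : Type*} [Semigroup S] (a : S) : Type _ := WithZero (DClass a)

namespace PrincipalFactor

variable {S : Type*} [Semigroup S] {a : S}

/-- The adjoined zero element. -/
instance : Zero (PrincipalFactor a) := inferInstanceAs (Zero (WithZero (DClass a)))

/-- The inclusion of `D_a` in `D_a ∪ {0}`. -/
def of (x : DClass a) : PrincipalFactor a := (x : WithZero (DClass a))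

theorem of_injective : Function.Injective (of : DClass a → PrincipalFactor a) :=
  fun _ _ h => WithZero.coe_inj.1 h

theorem of_ne_zero (x : DClass a) : of x ≠ 0 := WithZero.coe_ne_zero

theorem cases (p : PrincipalFactor a) : p = 0 ∨ ∃ x, p = of x := by
  rcases p with _ | x
  · exact Or.inl rfl
  · exact Or.inr ⟨x, rfl⟩

open Classical in
/-- The product of `x, y ∈ D_a` is `x * y` if this lies in `D_a`, and `0` otherwise. -/
noncomputable instance : Mul (PrincipalFactor a) where
  mul p q := match p, q with
    | some x, some y => if h : GreenD a (x.1 * y.1) then of ⟨x.1 * y.1, h⟩ else 0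
    | _, _ => 0

theorem zero_mul' (p : PrincipalFactor a) : 0 * p = 0 := rfl

theorem mul_zero' (p : PrincipalFactor a) : p * 0 = 0 := by
  rcases p with _ | x <;> rfl

theorem of_mul_of_pos (x y : DClass a) (h : GreenD a (x.1 * y.1)) :
    of x * of y = of ⟨x.1 * y.1, h⟩ := dif_pos h

theorem of_mul_of_neg (x y : DClass a) (h : ¬ GreenD a (x.1 * y.1)) :
    of x * of y = 0 := dif_neg h

noncomputable instance [Finite S] : Semigroup (PrincipalFactor a) where
  mul_assoc p q r := by
    rcases cases p with rfl | ⟨x, rfl⟩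
    · simp only [zero_mul']
    rcases cases q with rfl | ⟨y, rfl⟩
    · simp only [zero_mul', mul_zero']
    rcases cases r with rfl | ⟨z, rfl⟩
    · simp only [mul_zero']
    by_cases h : GreenD a (x.1 * y.1 * z.1)
    · have h1 : GreenD a (x.1 * y.1) :=
        greenD_iff.2 ⟨h.leJ.trans (leJ_mul_left _ _), (leJ_mul_left _ _).trans x.2.leJ'⟩
      have h' : GreenD a (x.1 * (y.1 * z.1)) := by rwa [← mul_assoc]
      have h2 : GreenD a (y.1 * z.1) :=
        greenD_iff.2 ⟨h'.leJ.trans (leJ_mul_right _ _), (leJ_mul_left _ _).trans y.2.leJ'⟩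
      rw [of_mul_of_pos x y h1, of_mul_of_pos y z h2, of_mul_of_pos _ _ h, of_mul_of_pos _ _ h']
      congr 2
      exact mul_assoc _ _ _
    · have h' : ¬ GreenD a (x.1 * (y.1 * z.1)) := by rwa [← mul_assoc]
      have e1 : of x * of y * of z = 0 := by
        by_cases h1 : GreenD a (x.1 * y.1)
        · rw [of_mul_of_pos x y h1, of_mul_of_neg _ _ h]
        · rw [of_mul_of_neg x y h1, zero_mul']
      have e2 : of x * (of y * of z) = 0 := by
        by_cases h1 : GreenD a (y.1 * z.1)
        · rw [of_mul_of_pos y z h1, of_mul_of_neg _ _ h']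
        · rw [of_mul_of_neg y z h1, mul_zero']
      rw [e1, e2]

/-- The relation `𝓗` on `D_a ∪ {0}`: the relation `𝓗` of `S` on `D_a`, with `{0}` as a further
class. It is a congruence of the principal factor. -/
noncomputable def hCon [Finite S] (a : S) : Con (PrincipalFactor a) where
  r p q := p = q ∨ ∃ x y : DClass a, p = of x ∧ q = of y ∧ GreenH x.1 y.1
  iseqv :=
    { refl := fun _ => Or.inl rfl
      symm := by
        rintro p q (rfl | ⟨x, y, rfl, rfl, h⟩)
        · exact Or.inl rfl
        · exact Or.inr ⟨y, x, rfl, rfl, h.1.symm, h.2.symm⟩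
      trans := by
        rintro p q r (rfl | ⟨x, y, rfl, rfl, h⟩) (rfl | ⟨y', z, e, rfl, k⟩)
        · exact Or.inl rfl
        · exact Or.inr ⟨y', z, e, rfl, k⟩
        · exact Or.inr ⟨x, y, rfl, rfl, h⟩
        · obtain rfl := of_injective e
          exact Or.inr ⟨x, z, rfl, rfl, h.1.trans k.1, h.2.trans k.2⟩ }
  mul' := by
    have key : ∀ x x' y y' : DClass a, GreenH x.1 x'.1 → GreenH y.1 y'.1 →
        (of x * of y = of x' * of y' ∨ ∃ z z' : DClass a, of x * of y = of z ∧
          of x' * of y' = of z' ∧ GreenH z.1 z'.1) := by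
      intro x x' y y' hx hy
      have hL : GreenL (x.1 * y.1) (x'.1 * y.1) := hx.1.mul_right _
      have hR : GreenR (x'.1 * y.1) (x'.1 * y'.1) := hy.2.mul_left _
      have hJ : LeJ (x.1 * y.1) (x'.1 * y'.1) := hL.leJ.trans hR.leJ
      have hJ' : LeJ (x'.1 * y'.1) (x.1 * y.1) := hR.symm.leJ.trans hL.symm.leJ
      by_cases h : GreenD a (x.1 * y.1)
      · have h' : GreenD a (x'.1 * y'.1) := greenD_iff.2 ⟨h.leJ.trans hJ, hJ'.trans h.leJ'⟩
        refine Or.inr ⟨_, _, of_mul_of_pos x y h, of_mul_of_pos x' y' h', ?_, ?_⟩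
        · exact ((greenL_mul_of_leJ (y.2.leJ'.trans h.leJ)).trans hy.1).trans
            (greenL_mul_of_leJ (y'.2.leJ'.trans h'.leJ)).symm
        · exact ((greenR_mul_of_leJ (x.2.leJ'.trans h.leJ)).trans hx.2).trans
            (greenR_mul_of_leJ (x'.2.leJ'.trans h'.leJ)).symm
      · have h' : ¬ GreenD a (x'.1 * y'.1) := fun h' =>
          h (greenD_iff.2 ⟨h'.leJ.trans hJ', hJ.trans h'.leJ'⟩)
        left
        rw [of_mul_of_neg x y h, of_mul_of_neg x' y' h']
    intro p p' q q' hp hq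
    rcases hp with rfl | ⟨x, x', rfl, rfl, hx⟩
    · rcases hq with rfl | ⟨y, y', rfl, rfl, hy⟩
      · exact Or.inl rfl
      · rcases cases p with rfl | ⟨x, rfl⟩
        · exact Or.inl rfl
        · exact key x x y y' ⟨GreenL.refl _, GreenR.refl _⟩ hy
    · rcases hq with rfl | ⟨y, y', rfl, rfl, hy⟩
      · rcases cases q with rfl | ⟨y, rfl⟩
        · left
          rw [mul_zero', mul_zero']
        · exact key x x' y y hx ⟨GreenL.refl _, GreenR.refl _⟩
      · exact key x x' y y' hx hy

end PrincipalFactor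

/-- The semigroup `(D_a ∪ {0}) / 𝓗`, a `0`-rectangular band when `S` is regular. -/
abbrev HQuotient {S : Type*} [Semigroup S] [Finite S] (a : S) : Type _ :=
  (PrincipalFactor.hCon a).Quotient

/-- The zero of `(D_a ∪ {0}) / 𝓗`. -/
noncomputable def HQuotient.zero {S : Type*} [Semigroup S] [Finite S] (a : S) : HQuotient a :=
  ((0 : PrincipalFactor a) : (PrincipalFactor.hCon a).Quotient)

/-- A rectangular band: a nonempty semigroup of idempotents satisfying `x y x = x`. -/
def IsRectangularBand (U : Type*) [Semigroup U] : Prop :=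
  Nonempty U ∧ (∀ x : U, x * x = x) ∧ ∀ x y : U, x * y * x = x

/-- A maximal rectangular subband of `(D_a ∪ {0}) / 𝓗`. The trivial subband `{0}` (the only
rectangular subband that contains the zero) is not counted among these. -/
def IsMaximalRectangularSubband {S : Type*} [Semigroup S] [Finite S] {a : S}
    (U : Subsemigroup (HQuotient a)) : Prop :=
  HQuotient.zero a ∉ U ∧ Maximal (fun W : Subsemigroup (HQuotient a) => IsRectangularBand W) U

/-- The number of `𝓡`-classes. -/
noncomputable def numR (U : Type*) [Semigroup U] : ℕ := Nat.card (Quot (GreenR (S := U)))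

/-- The number of `𝓛`-classes. -/
noncomputable def numL (U : Type*) [Semigroup U] : ℕ := Nat.card (Quot (GreenL (S := U)))

/-- Finite rectangular bands are similar if their ratios of the number of `𝓡`-classes to the
number of `𝓛`-classes agree. -/
def SimilarBands (U₁ U₂ : Type*) [Semigroup U₁] [Semigroup U₂] : Prop :=
  (numR U₁ : ℚ) / numL U₁ = (numR U₂ : ℚ) / numL U₂

end InverseMatching

open InverseMatching

/-! Both the existence of a matching and the similarity of the bands are equivalent to one numerical
condition: mutually inverse elements have equally many inverses.

An inverse `b` of `a` is determined by the idempotents `a * b` and `b * a`, which may be any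
idempotents of the 𝓡-class and of the 𝓛-class of `a`; so the number of inverses is a product
(`card_inverses`). On 𝓗-classes, being inverse is a symmetric relation. `E`-solidity makes it
difunctional (`IsESolid.difunctional`): classes with one common neighbour have all neighbours in
common. Related classes have the same size, so a permutation matching, which injects the
neighbourhood of `y` into that of its inverse `x`, forces the counts to agree. Conversely, equal
counts allow the classes to be labelled so that each has exactly one neighbour with its own label
(`exists_labelling`); sending `a` to its inverse in that class is an involution.

On the side of the bands, `E`-solidity splits the idempotents of a 𝓓-class into blocks, which are
exactly the maximal rectangular subbands. The block of `e` has as many 𝓡-classes as the 𝓛-class of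
`e` has idempotents, and dually. For `e = x * y` and `f = y * x`, with `x`, `y` mutually inverse,
similarity of the two blocks is then equality of the counts for `x` and `y`; any two 𝓓-related
idempotents have this form. -/

namespace InverseMatching

/-! ### Inverses, idempotents and 𝓗-classes -/

section Inverses

variable {S : Type*} [Semigroup S]

theorem GreenH.refl (a : S) : GreenH a a := ⟨GreenL.refl a, GreenR.refl a⟩

theorem GreenH.symm {a b : S} (h : GreenH a b) : GreenH b a := ⟨h.1.symm, h.2.symm⟩

theorem GreenH.trans {a b c : S} (h : GreenH a b) (k : GreenH b c) : GreenH a c :=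
  ⟨h.1.trans k.1, h.2.trans k.2⟩

theorem GreenR.of_mul {a b u v : S} (h : a = b * u) (k : b = a * v) : GreenR a b :=
  ⟨⟨u, by rw [h, WithOne.coe_mul]⟩, ⟨v, by rw [k, WithOne.coe_mul]⟩⟩

theorem GreenL.of_mul {a b u v : S} (h : a = u * b) (k : b = v * a) : GreenL a b :=
  ⟨⟨u, by rw [h, WithOne.coe_mul]⟩, ⟨v, by rw [k, WithOne.coe_mul]⟩⟩

theorem GreenR.idem_mul {a e : S} (h : GreenR a e) (he : IsIdempotentElem e) : e * a = a := by
  obtain ⟨⟨u, hu⟩, -⟩ := h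
  rw [← WithOne.coe_inj, WithOne.coe_mul, hu, ← mul_assoc, ← WithOne.coe_mul, he.eq]

theorem GreenL.mul_idem {a e : S} (h : GreenL a e) (he : IsIdempotentElem e) : a * e = a := by
  obtain ⟨⟨u, hu⟩, -⟩ := h
  rw [← WithOne.coe_inj, WithOne.coe_mul, hu, mul_assoc, ← WithOne.coe_mul, he.eq]

theorem GreenR.exists_mul {a e : S} (h : GreenR a e) (he : IsIdempotentElem e) :
    ∃ u : S, e = a * u := by
  obtain ⟨-, ⟨u, hu⟩⟩ := h
  induction u using WithOne.recOneCoe with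
  | one =>
    rw [mul_one, WithOne.coe_inj] at hu
    exact ⟨e, by rw [← hu, he.eq]⟩
  | coe u => exact ⟨u, by rw [← WithOne.coe_inj, hu, WithOne.coe_mul]⟩

theorem GreenL.exists_mul {a e : S} (h : GreenL a e) (he : IsIdempotentElem e) :
    ∃ u : S, e = u * a := by
  obtain ⟨-, ⟨u, hu⟩⟩ := h
  induction u using WithOne.recOneCoe with
  | one =>
    rw [one_mul, WithOne.coe_inj] at hu
    exact ⟨e, by rw [← hu, he.eq]⟩
  | coe u => exact ⟨u, by rw [← WithOne.coe_inj, hu, WithOne.coe_mul]⟩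

theorem GreenH.eq_of_idem {e f : S} (h : GreenH e f) (he : IsIdempotentElem e)
    (hf : IsIdempotentElem f) : e = f := by
  rw [← h.1.mul_idem hf, h.2.symm.idem_mul he]

/-- An `𝓗`-class containing an element and its square contains an idempotent. -/
theorem exists_idem_greenH {x : S} (h : GreenH x (x * x)) :
    ∃ e : S, IsIdempotentElem e ∧ GreenH x e := by
  obtain ⟨⟨⟨v, hv⟩, -⟩, ⟨⟨u, hu⟩, -⟩⟩ := h
  rw [WithOne.coe_mul] at hu hv
  -- Both sides equal `v * (x * x) * u`; this common value is the identity of the 𝓗-class.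
  have hvu : v * (x : WithOne S) = x * u := by
    calc v * (x : WithOne S) = v * (x * x * u) := by rw [← hu]
      _ = v * (x * x) * u := by simp only [mul_assoc]
      _ = x * u := by rw [← hv]
  have hex : ∃ e : S, (e : WithOne S) = x * u := by
    induction u using WithOne.recOneCoe with
    | one => exact ⟨x, by simp⟩
    | coe u => exact ⟨x * u, by simp⟩
  obtain ⟨e, he⟩ := hex
  have h1 : (e : WithOne S) * x = x := by rw [he, ← hvu, mul_assoc, ← hv]
  have h2 : (x : WithOne S) * e = x := by rw [he, ← mul_assoc, ← hu]
  refine ⟨e, ?_, ⟨⟨x, h2.symm⟩, ⟨v, by rw [he, hvu]⟩⟩, ⟨⟨x, h1.symm⟩, ⟨u, he⟩⟩⟩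
  show e * e = e
  rw [← WithOne.coe_inj, WithOne.coe_mul]
  nth_rw 2 [he]
  rw [← mul_assoc, h1, he]

theorem IsInverse.symm {a b : S} (h : IsInverse a b) : IsInverse b a := ⟨h.2, h.1⟩

theorem IsInverse.idem {a b : S} (h : IsInverse a b) : IsIdempotentElem (a * b) := by
  show a * b * (a * b) = a * b
  rw [← mul_assoc, h.1]

theorem IsInverse.greenR {a b : S} (h : IsInverse a b) : GreenR a (a * b) :=
  GreenR.of_mul h.1.symm rfl

theorem IsInverse.greenL {a b : S} (h : IsInverse a b) : GreenL b (a * b) :=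
  GreenL.of_mul (by rw [← mul_assoc]; exact h.2.symm) rfl

theorem IsRegularSemigroup.exists_inverse (hS : IsRegularSemigroup S) (a : S) :
    ∃ b, IsInverse a b := by
  obtain ⟨x, hx⟩ := hS a
  refine ⟨x * a * x, ?_, ?_⟩
  · calc a * (x * a * x) * a = a * x * a * x * a := by simp only [mul_assoc]
      _ = a := by rw [hx, hx]
  · calc x * a * x * a * (x * a * x) = x * (a * x * a) * x * a * x := by simp only [mul_assoc]
      _ = x * (a * x * a) * x := by
          conv_lhs => rw [hx]
          simp only [mul_assoc]
      _ = x * a * x := by rw [hx]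

/-- Two `𝓗`-related inverses of the same element are equal. -/
theorem IsInverse.eq_of_greenH {a b c : S} (hb : IsInverse a b) (hc : IsInverse a c)
    (h : GreenH b c) : b = c := by
  have h1 : a * b = a * c := GreenH.eq_of_idem
    ⟨hb.greenL.symm.trans (h.1.trans hc.greenL), hb.greenR.symm.trans hc.greenR⟩ hb.idem hc.idem
  have h2 : b * a = c * a := GreenH.eq_of_idem
    ⟨hb.symm.greenL.symm.trans hc.symm.greenL, hb.symm.greenR.symm.trans (h.2.trans hc.symm.greenR)⟩
    hb.symm.idem hc.symm.idem
  rw [← hb.2, h2, mul_assoc, h1, ← mul_assoc, hc.2]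

/-- With `e = a * u`, the right inverse `u` is cut down by `f` on the left and `e` on the right,
which makes it a genuine inverse with the prescribed products. -/
theorem exists_inverse_of_idem {a e f : S} (he : IsIdempotentElem e) (hf : IsIdempotentElem f)
    (hR : GreenR a e) (hL : GreenL a f) : ∃ b, IsInverse a b ∧ a * b = e ∧ b * a = f := by
  obtain ⟨u, hu⟩ := hR.exists_mul he
  obtain ⟨v, hv⟩ := hL.exists_mul hf
  have haf := hL.mul_idem hf
  have hea := hR.idem_mul he
  have h1 : a * (f * u * e) = e := by
    rw [← mul_assoc, ← mul_assoc, haf, ← hu, he.eq]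
  have h2 : f * u * e * a = f := by
    calc f * u * e * a = v * (a * (u * (e * a))) := by
          conv_lhs => rw [hv]
          simp only [mul_assoc]
      _ = f := by rw [hea, ← mul_assoc a, ← hu, hea, hv]
  refine ⟨f * u * e, ⟨by rw [h1, hea], ?_⟩, h1, h2⟩
  rw [h2, ← mul_assoc, ← mul_assoc, hf.eq]

/-- An inverse of `a` can be transported to any element of the `𝓗`-class of `a`. -/
theorem IsInverse.transport {a a' b : S} (h : IsInverse a b) (ha : GreenH a a') :
    ∃ b', IsInverse a' b' ∧ GreenH b b' := by
  obtain ⟨b', hb', h1, h2⟩ := exists_inverse_of_idem h.idem h.symm.idem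
    (ha.2.symm.trans h.greenR) (ha.1.symm.trans h.symm.greenL)
  refine ⟨b', hb', h.greenL.trans ?_, h.symm.greenR.trans ?_⟩
  · rw [← h1]; exact hb'.greenL.symm
  · rw [← h2]; exact hb'.symm.greenR.symm

/-- In an `E`-solid semigroup the relation "some inverse of `x` is `𝓗`-related to `y`" is
difunctional. -/
theorem IsESolid.difunctional (hS : IsESolid S) {x y z w : S} (hxy : IsInverse x y)
    (hzy : IsInverse z y) (hzw : IsInverse z w) : ∃ w', IsInverse x w' ∧ GreenH w w' := by
  -- The idempotents `h` (𝓡-related to `x`, 𝓛-related to `w`) and `k` (𝓡-related to `w`, 𝓛-related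
  -- to `x`) serve as `x * w'` and `w' * x`.
  obtain ⟨h, hh, h1, h2⟩ := hS.2 (x * y) (z * y) (z * w) hxy.idem hzy.idem hzw.idem
    (hxy.greenL.symm.trans hzy.greenL) (hzy.greenR.symm.trans hzw.greenR)
  obtain ⟨k, hk, h3, h4⟩ := hS.2 (w * z) (y * z) (y * x) hzw.symm.idem hzy.symm.idem hxy.symm.idem
    (hzw.symm.greenL.symm.trans hzy.symm.greenL) (hzy.symm.greenR.symm.trans hxy.symm.greenR)
  obtain ⟨w', hw', e1, e2⟩ := exists_inverse_of_idem hh hk (hxy.greenR.trans h1)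
    (hxy.symm.greenL.trans h4.symm)
  refine ⟨w', hw', ?_, ?_⟩
  · refine (hzw.greenL.trans h2.symm).trans ?_
    rw [← e1]; exact hw'.greenL.symm
  · refine (hzw.symm.greenR.trans h3).trans ?_
    rw [← e2]; exact hw'.symm.greenR.symm

/-- The idempotents in the `𝓡`-class of `a`. -/
abbrev IdemR (a : S) : Type _ := {e : S // IsIdempotentElem e ∧ GreenR a e}

/-- The idempotents in the `𝓛`-class of `a`. -/
abbrev IdemL (a : S) : Type _ := {e : S // IsIdempotentElem e ∧ GreenL a e}

theorem card_idemR_congr {a b : S} (h : GreenR a b) : Nat.card (IdemR a) = Nat.card (IdemR b) :=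
  Nat.card_congr (Equiv.subtypeEquivRight fun _ =>
    and_congr_right fun _ => ⟨fun k => h.symm.trans k, fun k => h.trans k⟩)

theorem card_idemL_congr {a b : S} (h : GreenL a b) : Nat.card (IdemL a) = Nat.card (IdemL b) :=
  Nat.card_congr (Equiv.subtypeEquivRight fun _ =>
    and_congr_right fun _ => ⟨fun k => h.symm.trans k, fun k => h.trans k⟩)

theorem card_inverses (a : S) :
    Nat.card {b // IsInverse a b} = Nat.card (IdemR a) * Nat.card (IdemL a) := by
  rw [← Nat.card_prod]
  refine Nat.card_eq_of_bijective (fun b => (⟨a * b.1, b.2.idem, b.2.greenR⟩,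
    ⟨b.1 * a, b.2.symm.idem, b.2.symm.greenL⟩)) ⟨?_, ?_⟩
  · rintro ⟨b, hb⟩ ⟨c, hc⟩ h
    simp only [Prod.mk.injEq, Subtype.mk.injEq] at h
    refine Subtype.ext (hb.eq_of_greenH hc ⟨hb.greenL.trans ?_, hb.symm.greenR.trans ?_⟩)
    · rw [h.1]; exact hc.greenL.symm
    · rw [h.2]; exact hc.symm.greenR.symm
  · rintro ⟨⟨e, he, hR⟩, ⟨f, hf, hL⟩⟩
    obtain ⟨b, hb, h1, h2⟩ := exists_inverse_of_idem he hf hR hL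
    exact ⟨⟨b, hb⟩, by simp [h1, h2]⟩

end Inverses

/-! ### Counting along the inverse relation, and matchings -/

section Matchings

variable {S : Type*} [Semigroup S]

/-- Transport sends each member of the class of `a` to an inverse of it in the class of `b`; this is
injective because an element has at most one inverse in a given 𝓗-class. -/
theorem card_greenH_le [Finite S] {a b : S} (h : IsInverse a b) :
    Nat.card {x // GreenH a x} ≤ Nat.card {x // GreenH b x} := by
  choose φ hφ using fun x : {x // GreenH a x} => h.transport x.2
  refine Nat.card_le_card_of_injective (fun x => ⟨φ x, (hφ x).2⟩) ?_
  intro x y hxy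
  have e : φ x = φ y := congrArg Subtype.val hxy
  have hy := (hφ y).1.symm
  rw [← e] at hy
  exact Subtype.ext ((hφ x).1.symm.eq_of_greenH hy (x.2.symm.trans y.2))

theorem card_greenH_eq [Finite S] {a b : S} (h : IsInverse a b) :
    Nat.card {x // GreenH a x} = Nat.card {x // GreenH b x} :=
  le_antisymm (card_greenH_le h) (card_greenH_le h.symm)

/-- Distinct inverses of `a` lie in distinct 𝓗-classes, each as large as that of `a`. -/
theorem card_greenH_inverses [Finite S] (a : S) :
    Nat.card {x // ∃ b, IsInverse a b ∧ GreenH b x} =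
      Nat.card {b // IsInverse a b} * Nat.card {x // GreenH a x} := by
  have e : (Σ b : {b // IsInverse a b}, {x // GreenH b.1 x}) ≃
      {x // ∃ b, IsInverse a b ∧ GreenH b x} := by
    refine Equiv.ofBijective (fun p => ⟨p.2.1, p.1.1, p.1.2, p.2.2⟩) ⟨?_, ?_⟩
    · rintro ⟨⟨b, hb⟩, ⟨x, hx⟩⟩ ⟨⟨c, hc⟩, ⟨y, hy⟩⟩ h
      obtain rfl : x = y := congrArg Subtype.val h
      obtain rfl := hb.eq_of_greenH hc (hx.trans hy.symm)
      rfl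
    · rintro ⟨x, b, hb, hx⟩
      exact ⟨⟨⟨b, hb⟩, ⟨x, hx⟩⟩, rfl⟩
  have := Fintype.ofFinite {b // IsInverse a b}
  rw [← Nat.card_congr e, Nat.card_sigma, Finset.sum_congr rfl
    (fun b _ => (card_greenH_eq b.2).symm), Finset.sum_const, Finset.card_univ,
    smul_eq_mul, Nat.card_eq_fintype_card (α := {b // IsInverse a b})]

theorem IsPermutationMatching.card_inverses_le [Finite S] (hS : IsESolid S) {f : S → S}
    (hf : IsPermutationMatching f) {x y : S} (h : IsInverse x y) :
    Nat.card {b // IsInverse y b} ≤ Nat.card {b // IsInverse x b} := by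
  have key : Nat.card {z // ∃ b, IsInverse y b ∧ GreenH b z} ≤
      Nat.card {z // ∃ b, IsInverse x b ∧ GreenH b z} := by
    refine Nat.card_le_card_of_injective (fun z => ⟨f z.1, ?_⟩) ?_
    -- Here `f z` is 𝓗-related to an inverse `w` of `b`; as `x` and `b` share the inverse `y`,
    -- difunctionality yields an inverse of `x` in the class of `w`.
    · obtain ⟨z, b, hb, hz⟩ := z
      obtain ⟨w, hw, hw'⟩ := (hf.1 z).transport hz.symm
      obtain ⟨w', h1, h2⟩ := hS.difunctional h hb.symm hw
      exact ⟨w', h1, (hw'.trans h2).symm⟩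
    · intro z z' hz
      exact Subtype.ext (hf.2.1 (congrArg Subtype.val hz))
  rw [card_greenH_inverses, card_greenH_inverses, card_greenH_eq h] at key
  have : Nonempty {z // GreenH y z} := ⟨⟨y, GreenH.refl y⟩⟩
  exact Nat.le_of_mul_le_mul_right key Nat.card_pos

theorem IsPermutationMatching.card_inverses_eq [Finite S] (hS : IsESolid S) {f : S → S}
    (hf : IsPermutationMatching f) {x y : S} (h : IsInverse x y) :
    Nat.card {b // IsInverse x b} = Nat.card {b // IsInverse y b} :=
  le_antisymm (hf.card_inverses_le hS h.symm) (hf.card_inverses_le hS h)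

/-- A total symmetric difunctional relation on a finite type, related elements of which have
equally many neighbours, has a labelling of the points such that every point has exactly one
neighbour with its own label. -/
theorem exists_labelling {α : Type*} [Finite α] (T : α → α → Prop) (htot : ∀ x, ∃ y, T x y)
    (hsymm : ∀ x y, T x y → T y x) (hdif : ∀ x y z w, T x y → T z y → T z w → T x w)
    (hcard : ∀ x y, T x y → Nat.card {z // T x z} = Nat.card {z // T y z}) :
    ∃ g : α → ℕ, ∀ x, ∃! y, T x y ∧ g y = g x := by
  -- `r x` is a neighbour of `x` chosen from the predicate `T x` alone, so that points with the same
  -- neighbourhood get the same `r`. The label of `w` is its index among the neighbours of `r w`.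
  obtain ⟨r, hr, hrc⟩ : ∃ r : α → α, (∀ x, T (r x) x) ∧
      ∀ x y z, T z x → T z y → r x = r y := by
    refine ⟨fun x => @Classical.epsilon α ⟨x⟩ (T x),
      fun x => hsymm _ _ (Classical.epsilon_spec (htot x)), fun x y z hx hy => ?_⟩
    have : T x = T y := by
      ext w
      exact ⟨hdif y z x w (hsymm _ _ hy) (hsymm _ _ hx),
        hdif x z y w (hsymm _ _ hx) (hsymm _ _ hy)⟩
    simp only [this]
  let e : ∀ z, {w // T z w} ≃ Fin (Nat.card {w // T z w}) := fun z => Finite.equivFin _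
  have he : ∀ z w (hw : T z w), z = r w → (e (r w) ⟨w, hr w⟩ : ℕ) = e z ⟨w, hw⟩ := by
    rintro z w hw rfl
    rfl
  refine ⟨fun w => e (r w) ⟨w, hr w⟩, fun x => ?_⟩
  obtain ⟨y, hy⟩ := htot x
  -- The points `r x`, `x`, `y`, `r y` form a chain of neighbours and so have equally many
  -- neighbours: the label of `x` is a valid index at `r y`.
  have hlt : (e (r x) ⟨x, hr x⟩ : ℕ) < Nat.card {w // T (r y) w} := by
    rw [hcard _ _ (hr y), ← hcard _ _ hy, ← hcard _ _ (hr x)]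
    exact (e (r x) ⟨x, hr x⟩).2
  obtain ⟨⟨w, hw⟩, hw'⟩ := (e (r y)).surjective ⟨_, hlt⟩
  have hxw := hdif x y (r y) w hy (hr y) hw
  refine ⟨w, ⟨hxw, ?_⟩, ?_⟩
  · simp only
    rw [he (r y) w hw (hrc _ _ _ hy hxw), hw']
  · rintro w' ⟨h1, h2⟩
    have hz := hrc _ _ _ hy h1
    have hw2 : T (r y) w' := by rw [hz]; exact hr w'
    simp only at h2
    rw [he (r y) w' hw2 hz] at h2
    have : (⟨w', hw2⟩ : {w // T (r y) w}) = ⟨w, hw⟩ := (e (r y)).injective (by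
      rw [hw']
      exact Fin.ext h2)
    exact congrArg Subtype.val this

/-- The labelling is applied to 𝓗-classes; a related class contains exactly one inverse of a given
element. -/
theorem exists_involutionMatching [Finite S] (hS : IsESolid S)
    (hC : ∀ x y : S, IsInverse x y →
      Nat.card {b // IsInverse x b} = Nat.card {b // IsInverse y b}) :
    ∃ f : S → S, IsInvolutionMatching f := by
  let H : Setoid S := ⟨GreenH, GreenH.refl, GreenH.symm, GreenH.trans⟩
  let π : S → Quotient H := Quotient.mk H
  have hπ : ∀ {a b}, π a = π b ↔ GreenH a b := Quotient.eq
  let T : Quotient H → Quotient H → Prop := fun p q => ∃ a b, π a = p ∧ π b = q ∧ IsInverse a b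
  have hT : ∀ a q, T (π a) q ↔ ∃ b, IsInverse a b ∧ π b = q := by
    refine fun a q => ⟨?_, fun ⟨b, hb, hq⟩ => ⟨a, b, rfl, hq, hb⟩⟩
    rintro ⟨a', b', ha, rfl, hb⟩
    obtain ⟨b, hb, hb'⟩ := hb.transport (hπ.1 ha)
    exact ⟨b, hb, hπ.2 hb'.symm⟩
  have hind : ∀ q, ∃ a, π a = q := Quotient.exists_rep
  have hcard : ∀ a, Nat.card {q // T (π a) q} = Nat.card {b // IsInverse a b} := by
    refine fun a => (Nat.card_eq_of_bijective
      (fun b => ⟨π b.1, (hT a _).2 ⟨b.1, b.2, rfl⟩⟩) ⟨?_, ?_⟩).symm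
    · rintro ⟨b, hb⟩ ⟨c, hc⟩ h
      exact Subtype.ext (hb.eq_of_greenH hc (hπ.1 (congrArg Subtype.val h)))
    · rintro ⟨q, hq⟩
      obtain ⟨b, hb, rfl⟩ := (hT a q).1 hq
      exact ⟨⟨b, hb⟩, rfl⟩
  have hsymm : ∀ p q, T p q → T q p := fun p q ⟨a, b, ha, hb, h⟩ => ⟨b, a, hb, ha, h.symm⟩
  obtain ⟨g, hg⟩ := exists_labelling T
    (fun p => by
      obtain ⟨a, rfl⟩ := hind p
      obtain ⟨b, hb⟩ := hS.1.exists_inverse a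
      exact ⟨π b, (hT a _).2 ⟨b, hb, rfl⟩⟩)
    hsymm
    (fun p q s t h1 h2 h3 => by
      obtain ⟨z, rfl⟩ := hind s
      obtain ⟨y, hy, rfl⟩ := (hT z q).1 h2
      obtain ⟨w, hw, rfl⟩ := (hT z t).1 h3
      obtain ⟨x, hx, rfl⟩ := (hT y p).1 (hsymm _ _ h1)
      obtain ⟨w', h4, h5⟩ := hS.difunctional hx.symm hy hw
      exact (hT x _).2 ⟨w', h4, hπ.2 h5.symm⟩)
    (fun p q h => by
      obtain ⟨a, b, rfl, rfl, hab⟩ := h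
      rw [hcard, hcard, hC a b hab])
  have huniq : ∀ a, ∃! b, IsInverse a b ∧ g (π b) = g (π a) := by
    intro a
    obtain ⟨q, ⟨hq, hgq⟩, hu⟩ := hg (π a)
    obtain ⟨b, hb, rfl⟩ := (hT a q).1 hq
    refine ⟨b, ⟨hb, hgq⟩, fun c hc => hc.1.eq_of_greenH hb (hπ.1 ?_)⟩
    exact hu _ ⟨(hT a _).2 ⟨c, hc.1, rfl⟩, hc.2⟩
  choose f hf using fun a => (huniq a).exists
  -- `a` is an inverse of `f a` with the same label, hence it is the one chosen for `f a`.
  have hff : Function.Involutive f := fun a =>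
    (huniq (f a)).unique (hf (f a)) ⟨(hf a).1.symm, (hf a).2.symm⟩
  exact ⟨f, ⟨fun a => (hf a).1, hff.bijective⟩, hff.comp_self⟩

end Matchings

end InverseMatching

namespace InverseMatching

/-! ### Rectangular blocks of idempotents -/

section Blocks

variable {S : Type*} [Semigroup S]

theorem GreenD.trans_greenR {a x y : S} (h : GreenD a x) (k : GreenR x y) : GreenD a y := by
  obtain ⟨c, h1, h2⟩ := h
  exact ⟨c, h1, h2.trans k⟩

/-- Idempotents `e`, `f` are in the same rectangular block if some idempotent `g` satisfies
`e 𝓡 g 𝓛 f`. -/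
def SameBlock (e f : S) : Prop := ∃ g : S, IsIdempotentElem g ∧ GreenR e g ∧ GreenL g f

theorem SameBlock.refl {e : S} (he : IsIdempotentElem e) : SameBlock e e :=
  ⟨e, he, GreenR.refl e, GreenL.refl e⟩

theorem SameBlock.symm (hS : IsESolid S) {e f : S} (he : IsIdempotentElem e)
    (hf : IsIdempotentElem f) (h : SameBlock e f) : SameBlock f e := by
  obtain ⟨g, hg, h1, h2⟩ := h
  exact hS.2 f g e hf hg he h2.symm h1.symm

theorem SameBlock.trans (hS : IsESolid S) {e f k : S} (hf : IsIdempotentElem f)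
    (h : SameBlock e f) (h' : SameBlock f k) : SameBlock e k := by
  obtain ⟨g, hg, h1, h2⟩ := h
  obtain ⟨g', hg', h3, h4⟩ := h'
  obtain ⟨m, hm, h5, h6⟩ := hS.2 g f g' hg hf hg' h2 h3
  exact ⟨m, hm, h1.trans h5, h6.trans h4⟩

/-- The product of idempotents of the same block, modulo `𝓗`. -/
theorem SameBlock.mul (hS : IsESolid S) {e f : S} (he : IsIdempotentElem e)
    (hf : IsIdempotentElem f) (h : SameBlock e f) : GreenR e (e * f) ∧ GreenL (e * f) f := by
  obtain ⟨k, hk, h1, h2⟩ := h.symm hS he hf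
  obtain ⟨u, hu⟩ := h1.exists_mul hk
  obtain ⟨v, hv⟩ := h2.symm.exists_mul hk
  have h3 : e * k = e := h2.symm.mul_idem hk
  have h4 : k * f = f := h1.idem_mul hk
  refine ⟨GreenR.of_mul (u := u) (v := f) ?_ rfl, GreenL.of_mul (u := e) (v := v) rfl ?_⟩
  · rw [mul_assoc, ← hu, h3]
  · rw [← mul_assoc, ← hv, h4]

theorem IsInverse.card_inverses_eq_iff {x y : S} (h : IsInverse x y) :
    Nat.card {b // IsInverse x b} = Nat.card {b // IsInverse y b} ↔
      Nat.card (IdemR (x * y)) * Nat.card (IdemL (y * x)) =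
        Nat.card (IdemR (y * x)) * Nat.card (IdemL (x * y)) := by
  rw [card_inverses, card_inverses, card_idemR_congr h.greenR, card_idemL_congr h.symm.greenL,
    card_idemR_congr h.symm.greenR, card_idemL_congr h.greenL]

end Blocks

/-! ### Maximal rectangular subbands as blocks -/

section Bands

variable {S : Type*} [Semigroup S] [Finite S] {a : S}

/-- The class in `(D_a ∪ {0}) / 𝓗` of an element of `D_a`. -/
noncomputable def HQuotient.of (x : DClass a) : HQuotient a :=
  (PrincipalFactor.of x : (PrincipalFactor.hCon a).Quotient)

theorem HQuotient.cases (p : HQuotient a) : p = zero a ∨ ∃ x, p = of x := by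
  induction p using Con.induction_on with
  | H p =>
    rcases PrincipalFactor.cases p with rfl | ⟨x, rfl⟩
    · exact Or.inl rfl
    · exact Or.inr ⟨x, rfl⟩

theorem HQuotient.of_eq_of {x y : DClass a} : of x = of y ↔ GreenH x.1 y.1 := by
  refine (Con.eq _).trans ⟨?_, fun h => Or.inr ⟨x, y, rfl, rfl, h⟩⟩
  rintro (h | ⟨x', y', hx, hy, h⟩)
  · rw [PrincipalFactor.of_injective h]
    exact GreenH.refl _
  · rw [PrincipalFactor.of_injective hx, PrincipalFactor.of_injective hy]
    exact h

theorem HQuotient.of_ne_zero (x : DClass a) : of x ≠ zero a := by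
  intro h
  rcases (Con.eq _).1 h with h | ⟨x', y', -, hy, -⟩
  · exact PrincipalFactor.of_ne_zero x h
  · exact PrincipalFactor.of_ne_zero y' hy.symm

theorem HQuotient.of_mul_of {x y : DClass a} (h : GreenD a (x.1 * y.1)) :
    of x * of y = of ⟨x.1 * y.1, h⟩ :=
  congrArg (fun p : PrincipalFactor a => (p : (PrincipalFactor.hCon a).Quotient))
    (PrincipalFactor.of_mul_of_pos x y h)

theorem HQuotient.of_mul_of_neg {x y : DClass a} (h : ¬ GreenD a (x.1 * y.1)) :
    of x * of y = zero a :=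
  congrArg (fun p : PrincipalFactor a => (p : (PrincipalFactor.hCon a).Quotient))
    (PrincipalFactor.of_mul_of_neg x y h)

theorem HQuotient.zero_mul (p : HQuotient a) : zero a * p = zero a := by
  induction p using Con.induction_on with
  | H p =>
    exact congrArg (fun p : PrincipalFactor a => (p : (PrincipalFactor.hCon a).Quotient))
      (PrincipalFactor.zero_mul' p)

theorem HQuotient.mul_zero (p : HQuotient a) : p * zero a = zero a := by
  induction p using Con.induction_on with
  | H p =>
    exact congrArg (fun p : PrincipalFactor a => (p : (PrincipalFactor.hCon a).Quotient))
      (PrincipalFactor.mul_zero' p)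

/-- As 𝓓 is defined as 𝓛 ∘ 𝓡, absorbing 𝓛 on the right goes through 𝓓 = 𝓙. -/
theorem GreenD.trans_greenL {x y : S} (h : GreenD a x) (k : GreenL x y) : GreenD a y :=
  greenD_iff.2 ⟨h.leJ.trans k.leJ, k.symm.leJ.trans h.leJ'⟩

theorem HQuotient.exists_idem_of_mul_self {p : HQuotient a} (hp : p * p = p) (h0 : p ≠ zero a) :
    ∃ x : DClass a, IsIdempotentElem x.1 ∧ p = of x := by
  obtain rfl | ⟨x, rfl⟩ := p.cases
  · exact absurd rfl h0
  by_cases h : GreenD a (x.1 * x.1)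
  · rw [of_mul_of h, of_eq_of] at hp
    obtain ⟨e, he, hxe⟩ := exists_idem_greenH hp.symm
    exact ⟨⟨e, x.2.trans_greenR hxe.2⟩, he, of_eq_of.2 hxe⟩
  · rw [of_mul_of_neg h] at hp
    exact absurd hp.symm h0

theorem HQuotient.of_mul_of_sameBlock (hS : IsESolid S) {x y z : DClass a}
    (hx : IsIdempotentElem x.1) (hy : IsIdempotentElem y.1) (h : SameBlock x.1 y.1)
    (hR : GreenR x.1 z.1) (hL : GreenL z.1 y.1) : of x * of y = of z := by
  obtain ⟨h1, h2⟩ := h.mul hS hx hy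
  rw [of_mul_of (x.2.trans_greenR h1), of_eq_of]
  exact ⟨h2.trans hL.symm, h1.symm.trans hR⟩

/-- The rectangular subband of `(D_a ∪ {0}) / 𝓗` given by the block of the idempotent `e`. -/
noncomputable def blockBand (hS : IsESolid S) {e : S} (he : IsIdempotentElem e) :
    Subsemigroup (HQuotient a) where
  carrier := {p | ∃ x : DClass a, IsIdempotentElem x.1 ∧ SameBlock e x.1 ∧ p = HQuotient.of x}
  mul_mem' := by
    rintro _ _ ⟨x, hx, hex, rfl⟩ ⟨y, hy, hey, rfl⟩
    have hxy := (hex.symm hS he hx).trans hS he hey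
    obtain ⟨z, hz, h1, h2⟩ := id hxy
    exact ⟨⟨z, x.2.trans_greenR h1⟩, hz, hex.trans hS hx ⟨z, hz, h1, GreenL.refl z⟩,
      HQuotient.of_mul_of_sameBlock hS hx hy hxy h1 h2⟩

theorem of_mem_blockBand (hS : IsESolid S) {e : S} (he : IsIdempotentElem e) {x : DClass a}
    (hx : IsIdempotentElem x.1) :
    HQuotient.of x ∈ blockBand (a := a) hS he ↔ SameBlock e x.1 := by
  refine ⟨?_, fun h => ⟨x, hx, h, rfl⟩⟩
  rintro ⟨y, hy, hey, hxy⟩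
  rw [(HQuotient.of_eq_of.1 hxy).eq_of_idem hx hy]
  exact hey

theorem isRectangularBand_blockBand (hS : IsESolid S) {e : S} (he : IsIdempotentElem e)
    (hae : GreenD a e) : IsRectangularBand (blockBand (a := a) hS he) := by
  refine ⟨⟨⟨HQuotient.of ⟨e, hae⟩, ⟨e, hae⟩, he, SameBlock.refl he, rfl⟩⟩, ?_, ?_⟩
  · rintro ⟨_, x, hx, hex, rfl⟩
    exact Subtype.ext (HQuotient.of_mul_of_sameBlock hS hx hx (SameBlock.refl hx)
      (GreenR.refl _) (GreenL.refl _))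
  · rintro ⟨_, x, hx, hex, rfl⟩ ⟨_, y, hy, hey, rfl⟩
    have hxy := (hex.symm hS he hx).trans hS he hey
    obtain ⟨z, hz, h1, h2⟩ := id hxy
    refine Subtype.ext ?_
    show HQuotient.of x * HQuotient.of y * HQuotient.of x = HQuotient.of x
    rw [HQuotient.of_mul_of_sameBlock (z := ⟨z, x.2.trans_greenR h1⟩) hS hx hy hxy h1 h2]
    exact HQuotient.of_mul_of_sameBlock hS hz hx ⟨x.1, hx, h1.symm, GreenL.refl _⟩ h1.symm
      (GreenL.refl _)

theorem zero_notMem_blockBand (hS : IsESolid S) {e : S} (he : IsIdempotentElem e) :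
    HQuotient.zero a ∉ blockBand (a := a) hS he := by
  rintro ⟨x, -, -, h⟩
  exact HQuotient.of_ne_zero x h.symm

/-- A rectangular subband containing the class of a nonzero idempotent is contained in the
corresponding block. -/
theorem le_blockBand (hS : IsESolid S) {x : DClass a} (hx : IsIdempotentElem x.1)
    {U : Subsemigroup (HQuotient a)} (hU : IsRectangularBand U) (hxU : HQuotient.of x ∈ U) :
    U ≤ blockBand hS hx := by
  have hidem : ∀ p ∈ U, p * p = p := fun p hp => congrArg Subtype.val (hU.2.1 ⟨p, hp⟩)
  have hsand : ∀ p ∈ U, ∀ q ∈ U, p * q * p = p := fun p hp q hq =>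
    congrArg Subtype.val (hU.2.2 ⟨p, hp⟩ ⟨q, hq⟩)
  -- A zero in `U` would make the sandwich law collapse the class of `x` to zero.
  have h0 : HQuotient.zero a ∉ U := by
    intro h0
    have := hsand _ hxU _ h0
    rw [HQuotient.mul_zero, HQuotient.zero_mul] at this
    exact HQuotient.of_ne_zero x this.symm
  have hrep : ∀ p ∈ U, ∃ y : DClass a, IsIdempotentElem y.1 ∧ p = HQuotient.of y := fun p hp =>
    HQuotient.exists_idem_of_mul_self (hidem p hp) fun h => h0 (h ▸ hp)
  intro p hp
  -- The product of the classes of `x` and `y` is nonzero and represented by an idempotent `z`;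
  -- finiteness then places `z` in the 𝓡-class of `x` and the 𝓛-class of `y`.
  obtain ⟨y, hy, rfl⟩ := hrep p hp
  obtain ⟨z, hz, hxyz⟩ := hrep _ (U.mul_mem hxU hp)
  refine ⟨y, hy, ⟨z.1, hz, ?_⟩, rfl⟩
  by_cases h : GreenD a (x.1 * y.1)
  · rw [HQuotient.of_mul_of h, HQuotient.of_eq_of] at hxyz
    exact ⟨(greenR_mul_of_leJ (x.2.leJ'.trans h.leJ)).symm.trans hxyz.2,
      hxyz.1.symm.trans (greenL_mul_of_leJ (y.2.leJ'.trans h.leJ))⟩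
  · rw [HQuotient.of_mul_of_neg h] at hxyz
    exact absurd hxyz.symm (HQuotient.of_ne_zero z)

theorem isMaximalRectangularSubband_iff (hS : IsESolid S) {U : Subsemigroup (HQuotient a)} :
    IsMaximalRectangularSubband U ↔
      ∃ (e : S) (he : IsIdempotentElem e), GreenD a e ∧ U = blockBand hS he := by
  constructor
  · rintro ⟨h0, hU, hmax⟩
    obtain ⟨⟨p, hp⟩⟩ := hU.1
    obtain ⟨x, hx, rfl⟩ := HQuotient.exists_idem_of_mul_self
      (congrArg Subtype.val (hU.2.1 ⟨p, hp⟩)) fun h => h0 (h ▸ hp)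
    have hle := le_blockBand hS hx hU hp
    exact ⟨x.1, hx, x.2, le_antisymm hle (hmax (isRectangularBand_blockBand hS hx x.2) hle)⟩
  · rintro ⟨e, he, hae, rfl⟩
    refine ⟨zero_notMem_blockBand hS he, isRectangularBand_blockBand hS he hae, ?_⟩
    intro W hW hle
    exact le_blockBand (x := ⟨e, hae⟩) hS he hW
      (hle ((of_mem_blockBand hS he (x := ⟨e, hae⟩) he).2 (SameBlock.refl he)))

theorem greenR_blockBand_iff (hS : IsESolid S) {e : S} (he : IsIdempotentElem e) {x y : DClass a}
    (hx : IsIdempotentElem x.1) (hy : IsIdempotentElem y.1)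
    (hex : HQuotient.of x ∈ blockBand (a := a) hS he)
    (hey : HQuotient.of y ∈ blockBand (a := a) hS he) :
    GreenR (⟨_, hex⟩ : blockBand (a := a) hS he) ⟨_, hey⟩ ↔ GreenR x.1 y.1 := by
  have hxy := (((of_mem_blockBand hS he hx).1 hex).symm hS he hx).trans hS he
    ((of_mem_blockBand hS he hy).1 hey)
  constructor
  · rintro ⟨⟨u, hu⟩, -⟩
    induction u using WithOne.recOneCoe with
    | one =>
      rw [mul_one, WithOne.coe_inj] at hu
      exact (HQuotient.of_eq_of.1 (congrArg Subtype.val hu)).2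
    | coe u =>
      obtain ⟨_, z, hz, hez, rfl⟩ := u
      rw [← WithOne.coe_mul, WithOne.coe_inj] at hu
      have hyz := (hxy.symm hS hx hy).trans hS hx
        ((((of_mem_blockBand hS he hx).1 hex).symm hS he hx).trans hS he hez)
      obtain ⟨w, hw, h1, h2⟩ := id hyz
      have := (congrArg Subtype.val hu).trans (HQuotient.of_mul_of_sameBlock
        (z := ⟨w, y.2.trans_greenR h1⟩) hS hy hz hyz h1 h2)
      exact (HQuotient.of_eq_of.1 this).2.trans h1.symm
  · intro h
    exact GreenR.of_mul (u := ⟨_, hex⟩) (v := ⟨_, hey⟩)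
      (Subtype.ext (HQuotient.of_mul_of_sameBlock hS hy hx (hxy.symm hS hx hy) h.symm
        (GreenL.refl _)).symm)
      (Subtype.ext (HQuotient.of_mul_of_sameBlock hS hx hy hxy h (GreenL.refl _)).symm)

theorem greenL_blockBand_iff (hS : IsESolid S) {e : S} (he : IsIdempotentElem e) {x y : DClass a}
    (hx : IsIdempotentElem x.1) (hy : IsIdempotentElem y.1)
    (hex : HQuotient.of x ∈ blockBand (a := a) hS he)
    (hey : HQuotient.of y ∈ blockBand (a := a) hS he) :
    GreenL (⟨_, hex⟩ : blockBand (a := a) hS he) ⟨_, hey⟩ ↔ GreenL x.1 y.1 := by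
  have hxy := (((of_mem_blockBand hS he hx).1 hex).symm hS he hx).trans hS he
    ((of_mem_blockBand hS he hy).1 hey)
  constructor
  · rintro ⟨⟨u, hu⟩, -⟩
    induction u using WithOne.recOneCoe with
    | one =>
      rw [one_mul, WithOne.coe_inj] at hu
      exact (HQuotient.of_eq_of.1 (congrArg Subtype.val hu)).1
    | coe u =>
      obtain ⟨_, z, hz, hez, rfl⟩ := u
      rw [← WithOne.coe_mul, WithOne.coe_inj] at hu
      have hzy := (hez.symm hS he hz).trans hS he ((of_mem_blockBand hS he hy).1 hey)
      obtain ⟨w, hw, h1, h2⟩ := id hzy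
      have := (congrArg Subtype.val hu).trans (HQuotient.of_mul_of_sameBlock
        (z := ⟨w, z.2.trans_greenR h1⟩) hS hz hy hzy h1 h2)
      exact (HQuotient.of_eq_of.1 this).1.trans h2
  · intro h
    exact GreenL.of_mul (u := ⟨_, hex⟩) (v := ⟨_, hey⟩)
      (Subtype.ext (HQuotient.of_mul_of_sameBlock hS hx hy hxy (GreenR.refl _) h).symm)
      (Subtype.ext (HQuotient.of_mul_of_sameBlock hS hy hx (hxy.symm hS hx hy)
        (GreenR.refl _) h.symm).symm)

theorem equivalence_greenR (U : Type*) [Semigroup U] : Equivalence (GreenR (S := U)) :=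
  ⟨GreenR.refl, GreenR.symm, GreenR.trans⟩

theorem equivalence_greenL (U : Type*) [Semigroup U] : Equivalence (GreenL (S := U)) :=
  ⟨GreenL.refl, GreenL.symm, GreenL.trans⟩

/-- The idempotents 𝓛-related to `e` form a transversal of the 𝓡-classes of the block. -/
theorem numR_blockBand (hS : IsESolid S) {e : S} (he : IsIdempotentElem e) (hae : GreenD a e) :
    numR (blockBand (a := a) hS he) = Nat.card (IdemL e) := by
  have hmem : ∀ f : IdemL e, HQuotient.of ⟨f.1, hae.trans_greenL f.2.2⟩ ∈
      blockBand (a := a) hS he := fun f =>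
    (of_mem_blockBand hS he f.2.1).2 ⟨e, he, GreenR.refl e, f.2.2⟩
  refine (Nat.card_eq_of_bijective (fun f => Quot.mk _ ⟨_, hmem f⟩) ⟨?_, ?_⟩).symm
  · intro f f' h
    have h := ((equivalence_greenR _).eqvGen_iff).1 (Quot.eqvGen_exact h)
    have h := (greenR_blockBand_iff hS he f.2.1 f'.2.1 (hmem f) (hmem f')).1 h
    exact Subtype.ext (GreenH.eq_of_idem ⟨f.2.2.symm.trans f'.2.2, h⟩ f.2.1 f'.2.1)
  · rintro ⟨_, x, hx, hex, rfl⟩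
    obtain ⟨g, hg, h1, h2⟩ := hex.symm hS he hx
    refine ⟨⟨g, hg, h2.symm⟩, Quot.sound ?_⟩
    exact (greenR_blockBand_iff hS he hg hx _ _).2 h1.symm

theorem numL_blockBand (hS : IsESolid S) {e : S} (he : IsIdempotentElem e) (hae : GreenD a e) :
    numL (blockBand (a := a) hS he) = Nat.card (IdemR e) := by
  have hmem : ∀ f : IdemR e, HQuotient.of ⟨f.1, hae.trans_greenR f.2.2⟩ ∈
      blockBand (a := a) hS he := fun f =>
    (of_mem_blockBand hS he f.2.1).2 ⟨f.1, f.2.1, f.2.2, GreenL.refl _⟩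
  refine (Nat.card_eq_of_bijective (fun f => Quot.mk _ ⟨_, hmem f⟩) ⟨?_, ?_⟩).symm
  · intro f f' h
    have h := ((equivalence_greenL _).eqvGen_iff).1 (Quot.eqvGen_exact h)
    have h := (greenL_blockBand_iff hS he f.2.1 f'.2.1 (hmem f) (hmem f')).1 h
    exact Subtype.ext (GreenH.eq_of_idem ⟨h, f.2.2.symm.trans f'.2.2⟩ f.2.1 f'.2.1)
  · rintro ⟨_, x, hx, hex, rfl⟩
    obtain ⟨g, hg, h1, h2⟩ := id hex
    refine ⟨⟨g, hg, h1⟩, Quot.sound ?_⟩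
    exact (greenL_blockBand_iff hS he hg hx _ _).2 h2

theorem similarBands_blockBand_iff (hS : IsESolid S) {e f : S} (he : IsIdempotentElem e)
    (hf : IsIdempotentElem f) (hae : GreenD a e) (haf : GreenD a f) :
    SimilarBands (blockBand (a := a) hS he) (blockBand (a := a) hS hf) ↔
      Nat.card (IdemR e) * Nat.card (IdemL f) = Nat.card (IdemR f) * Nat.card (IdemL e) := by
  have : Nonempty (IdemR e) := ⟨⟨e, he, GreenR.refl e⟩⟩
  have : Nonempty (IdemR f) := ⟨⟨f, hf, GreenR.refl f⟩⟩
  have h1 : (Nat.card (IdemR e) : ℚ) ≠ 0 := Nat.cast_ne_zero.2 Nat.card_pos.ne'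
  have h2 : (Nat.card (IdemR f) : ℚ) ≠ 0 := Nat.cast_ne_zero.2 Nat.card_pos.ne'
  rw [SimilarBands, numR_blockBand hS he hae, numL_blockBand hS he hae, numR_blockBand hS hf haf,
    numL_blockBand hS hf haf, div_eq_div_iff h1 h2, ← Nat.cast_mul, ← Nat.cast_mul, Nat.cast_inj,
    mul_comm (Nat.card (IdemL e)), mul_comm (Nat.card (IdemL f)), eq_comm]

/-- All maximal rectangular subbands are similar if and only if mutually inverse elements have
equally many inverses. -/
theorem similarBands_iff_card_inverses (hS : IsESolid S) :
    (∀ a : S, ∀ U₁ U₂ : Subsemigroup (HQuotient a), IsMaximalRectangularSubband U₁ →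
      IsMaximalRectangularSubband U₂ → SimilarBands U₁ U₂) ↔
    ∀ x y : S, IsInverse x y →
      Nat.card {b // IsInverse x b} = Nat.card {b // IsInverse y b} := by
  constructor
  · intro h x y hxy
    have h1 : GreenD x (x * y) := ⟨x, GreenL.refl x, hxy.greenR⟩
    have h2 : GreenD x (y * x) := ⟨y * x, hxy.symm.greenL, GreenR.refl _⟩
    exact hxy.card_inverses_eq_iff.2 ((similarBands_blockBand_iff hS hxy.idem hxy.symm.idem h1 h2).1
      (h x _ _ ((isMaximalRectangularSubband_iff hS).2 ⟨_, hxy.idem, h1, rfl⟩)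
        ((isMaximalRectangularSubband_iff hS).2 ⟨_, hxy.symm.idem, h2, rfl⟩)))
  · intro h a U₁ U₂ hU₁ hU₂
    obtain ⟨e, he, hae, rfl⟩ := (isMaximalRectangularSubband_iff hS).1 hU₁
    obtain ⟨f, hf, haf, rfl⟩ := (isMaximalRectangularSubband_iff hS).1 hU₂
    -- Any `x` that is 𝓡-related to `e` and 𝓛-related to `f` has an inverse `y` with `x * y = e` and
    -- `y * x = f`.
    obtain ⟨x, hfx, hxe⟩ : GreenD f e :=
      greenD_iff.2 ⟨haf.leJ'.trans hae.leJ, hae.leJ'.trans haf.leJ⟩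
    obtain ⟨y, hxy, rfl, rfl⟩ := exists_inverse_of_idem he hf hxe hfx.symm
    exact (similarBands_blockBand_iff hS he hf hae haf).2
      (hxy.card_inverses_eq_iff.1 (h x y hxy))

end Bands

end InverseMatching

theorem theorem1p3p5 {S : Type*} [Semigroup S] [Finite S] (hS : IsESolid S) :
    ((∃ f : S → S, IsPermutationMatching f) ↔
      ∀ a : S, ∀ U₁ U₂ : Subsemigroup (HQuotient a),
        IsMaximalRectangularSubband U₁ → IsMaximalRectangularSubband U₂ → SimilarBands U₁ U₂) ∧
    ((∃ f : S → S, IsPermutationMatching f) → ∃ f : S → S, IsInvolutionMatching f) := by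
  have hC : (∃ f : S → S, IsPermutationMatching f) → ∀ x y : S, IsInverse x y →
      Nat.card {b // IsInverse x b} = Nat.card {b // IsInverse y b} := fun ⟨_, hf⟩ _ _ h =>
    hf.card_inverses_eq hS h
  rw [similarBands_iff_card_inverses hS]
  refine ⟨⟨hC, fun h => ?_⟩, fun h => exists_involutionMatching hS (hC h)⟩
  obtain ⟨f, hf⟩ := exists_involutionMatching hS h
  exact ⟨f, hf.1⟩
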